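/- An effect algebra is a set $E$ with elements $0,1$ and a partial binary operation $+$ such that, for all $a,b,c\in E$: (i) $a+b$ is defined iff $b+a$ is, and then $a+b=b+a$; (ii) $a+b$ and $(a+b)+c$ are defined iff $b+c$ and $a+(b+c)$ are, and then $(a+b)+c=a+(b+c)$; (iii) there is a unique $a'\in E$ with $a+a'=1$; (iv) if $a+1$ is defined, then $a=0$. It is partially ordered by: $a\le b$ iff $a+c=b$ for some $c\in E$; all suprema and infima below are taken in this order on $E$. $E$ is a $\sigma$-lattice effect algebra if every sequence in $E$ has a supremum and an infimum; it is monotone $\sigma$-complete if every increasing sequence in $E$ has a supremum; it has the Riesz Decomposition Property (RDP) if whenever $a_1+a_2=b_1+b_2$ (both sums being defined) there are $c_{11},c_{12},c_{21},c_{22}\in E$ with $a_1=c_{11}+c_{12}$, $a_2=c_{21}+c_{22}$, $b_1=c_{11}+c_{21}$, $b_2=c_{12}+c_{22}$. An element $a\in E$ is sharp if $a\wedge a'$ exists and equals $0$. An observable on $E$ is a map $x:\mathcal B(\mathbb R)\to E$ on the Borel sets of $\mathbb R$ such that $x(\mathbb R)=1$; $x(F)+x(G)$ is defined and $x(F\cup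 G)=x(F)+x(G)$ for all disjoint $F,G\in\mathcal B(\mathbb R)$; and $x(\bigcup_n F_n)=\bigvee_n x(F_n)$ for every increasing sequence $(F_n)$ in $\mathcal B(\mathbb R)$. It is sharp if $x(F)$ is sharp for every $F\in\mathcal B(\mathbb R)$. **Theorem.** Let $E$ be either a $\sigma$-lattice effect algebra or a monotone $\sigma$-complete effect algebra with RDP. Let $\{x_t:t\in\mathbb R\}$ be a system of sharp elements of $E$ such that $$x_t\le x_s\ \text{ if } t<s,\qquad \bigwedge_{t\in\mathbb R}x_t=0,\quad \bigvee_{t\in\mathbb R}x_t=1,\qquad \bigvee_{t<s}x_t=x_s\ \text{ for every } s\in\mathbb R.$$ Then there is a unique observable $x$ on $E$ such that $x((-\infty,t))=x_t$ for every $t\in\mathbb R$. Moreover, this observable is sharp, and it preserves finite intersections: for all $F,G\in\mathcal B(\mathbb R)$ the infimum $x(F)\wedge x(G)$ exists in $E$ and $x(F\cap G)=x(F)\wedge x(G)$. -/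

import Mathlib

/-- An effect algebra `(E; +, 0, 1)`. The partial addition is `padd : E → E → Option E`:
`padd a b = some s` says that `a + b` is defined and equals `s`, and `padd a b = none` says
that `a + b` is undefined. An equation between two `Option` values thus says that one side is
defined if and only if the other one is, and that they are then equal. -/
class EffectAlgebra (E : Type*) extends Zero E, One E where
  /-- the partially defined addition -/
  padd : E → E → Option E
  /-- commutativity -/
  padd_comm : ∀ a b : E, padd a b = padd b a
  /-- associativity: `(a + b) + c` is defined iff `a + (b + c)` is, and then they are equal -/
  padd_assoc : ∀ a b c : E,
    ((padd a b).bind fun s => padd s c) = ((padd b c).bind fun s => padd a s)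
  /-- every element has a unique orthosupplement -/
  existsUnique_compl : ∀ a : E, ∃! b : E, padd a b = some 1
  /-- if `a + 1` is defined, then `a = 0` -/
  eq_zero_of_padd_one : ∀ a : E, (padd a 1).isSome → a = 0

namespace EffectAlgebra

section
variable {E : Type*} [EffectAlgebra E]

theorem assoc_right {a b c s t : E} (h1 : padd a b = some s) (h2 : padd s c = some t) :
    ∃ u, padd b c = some u ∧ padd a u = some t := by
  have h := padd_assoc a b c
  rw [h1, Option.bind_some, h2] at h
  exact Option.bind_eq_some_iff.1 h.symm

theorem assoc_left {a b c u t : E} (h1 : padd b c = some u) (h2 : padd a u = some t) :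
    ∃ s, padd a b = some s ∧ padd s c = some t := by
  have h := padd_assoc a b c
  rw [h1, Option.bind_some, h2] at h
  exact Option.bind_eq_some_iff.1 h

theorem padd_one_zero : padd (1 : E) 0 = some 1 := by
  obtain ⟨c, hc, -⟩ := existsUnique_compl (1 : E)
  have h0 : c = 0 := eq_zero_of_padd_one c (by rw [padd_comm, hc]; rfl)
  rwa [h0] at hc

theorem padd_zero (a : E) : padd a 0 = some a := by
  obtain ⟨b, hb, -⟩ := existsUnique_compl a
  rw [padd_comm] at hb
  obtain ⟨u, hu, hbu⟩ := assoc_right hb padd_one_zero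
  rw [hu, (existsUnique_compl b).unique hbu hb]

theorem padd_left_cancel {a b c s : E} (hb : padd a b = some s) (hc : padd a c = some s) :
    b = c := by
  obtain ⟨d, hd, -⟩ := existsUnique_compl s
  rw [padd_comm] at hb hc
  obtain ⟨e, he, hbe⟩ := assoc_right hb hd
  obtain ⟨e', he', hce⟩ := assoc_right hc hd
  obtain rfl : e = e' := Option.some_injective _ (he.symm.trans he')
  rw [padd_comm] at hbe hce
  exact (existsUnique_compl e).unique hbe hce

theorem eq_zero_of_padd_eq_zero {a b : E} (h : padd a b = some 0) : a = 0 := by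
  obtain ⟨s, hs, -⟩ := assoc_left h padd_one_zero
  exact eq_zero_of_padd_one a (by rw [padd_comm, hs]; rfl)

/-- The natural partial order: `a ≤ b` iff `a + c = b` for some `c`. -/
instance instPartialOrder : PartialOrder E where
  le a b := ∃ c, padd a c = some b
  le_refl a := ⟨0, padd_zero a⟩
  le_trans a b c := by
    rintro ⟨d, hd⟩ ⟨e, he⟩
    obtain ⟨u, -, hu⟩ := assoc_right hd he
    exact ⟨u, hu⟩
  le_antisymm a b := by
    rintro ⟨c, hc⟩ ⟨d, hd⟩
    obtain ⟨u, hu, hau⟩ := assoc_right hc hd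
    have hu0 : u = 0 := padd_left_cancel hau (padd_zero a)
    rw [hu0] at hu
    have hc0 : c = 0 := eq_zero_of_padd_eq_zero hu
    rw [hc0, padd_zero] at hc
    exact Option.some_injective _ hc

theorem le_def {a b : E} : a ≤ b ↔ ∃ c, padd a c = some b := Iff.rfl

/-- The orthosupplement `a'`: the unique element with `a + a' = 1`. -/
noncomputable def orthosupp (a : E) : E := (existsUnique_compl a).choose

theorem padd_orthosupp (a : E) : padd a (orthosupp a) = some 1 :=
  (existsUnique_compl a).choose_spec.1

/-- An element `a` is sharp if `a ∧ a'` exists and equals `0`. -/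
def IsSharp (a : E) : Prop := IsGLB {a, orthosupp a} 0

end

/-- `E` is monotone σ-complete: every increasing sequence has a supremum. -/
def IsMonotoneSigmaComplete (E : Type*) [EffectAlgebra E] : Prop :=
  ∀ a : ℕ → E, (∀ n, a n ≤ a (n + 1)) → ∃ s, IsLUB (Set.range a) s

/-- `E` is a σ-lattice: every sequence has a supremum and an infimum (constant-from-some-point
sequences give the binary joins and meets). -/
def IsSigmaLattice (E : Type*) [EffectAlgebra E] : Prop :=
  ∀ a : ℕ → E, (∃ s, IsLUB (Set.range a) s) ∧ (∃ i, IsGLB (Set.range a) i)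

/-- The Riesz Decomposition Property. -/
def HasRDP (E : Type*) [EffectAlgebra E] : Prop :=
  ∀ a₁ a₂ b₁ b₂ s : E, padd a₁ a₂ = some s → padd b₁ b₂ = some s →
    ∃ c₁₁ c₁₂ c₂₁ c₂₂ : E,
      padd c₁₁ c₁₂ = some a₁ ∧ padd c₂₁ c₂₂ = some a₂ ∧
      padd c₁₁ c₂₁ = some b₁ ∧ padd c₁₂ c₂₂ = some b₂

/-- The Borel σ-algebra of `ℝ`, as a type. -/
abbrev BorelSets : Type := {B : Set ℝ // MeasurableSet B}

/-- An observable on `E`: a map `x` from the Borel sets of `ℝ` to `E` with `x(ℝ) = 1`,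
`x(F ∪ G) = x(F) + x(G)` (in particular the sum is defined) for disjoint `F`, `G`, and
`x(⋃ Fₙ) = ⋁ x(Fₙ)` for every increasing sequence `Fₙ`. -/
structure IsObservable {E : Type*} [EffectAlgebra E] (x : BorelSets → E) : Prop where
  map_univ : x ⟨Set.univ, MeasurableSet.univ⟩ = 1
  map_union : ∀ F G : BorelSets, Disjoint F.1 G.1 →
    padd (x F) (x G) = some (x ⟨F.1 ∪ G.1, F.2.union G.2⟩)
  map_iUnion : ∀ F : ℕ → BorelSets, (∀ n, (F n).1 ⊆ (F (n + 1)).1) →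
    IsLUB (Set.range fun n => x (F n)) (x ⟨⋃ n, (F n).1, MeasurableSet.iUnion fun n => (F n).2⟩)

/-- An observable is sharp if its range consists of sharp elements. -/
def IsSharpObservable {E : Type*} [EffectAlgebra E] (x : BorelSets → E) : Prop :=
  IsObservable x ∧ ∀ F, IsSharp (x F)

/-- `x` preserves finite intersections: `x(F) ∧ x(G)` exists in `E` and equals `x(F ∩ G)`. -/
def PreservesInter {E : Type*} [EffectAlgebra E] (x : BorelSets → E) : Prop :=
  ∀ F G : BorelSets, IsGLB {x F, x G} (x ⟨F.1 ∩ G.1, F.2.inter G.2⟩)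

end EffectAlgebra

/-!
Say that a sharp element `a` *splits* `e` if `e` is a sum of an element below `a` and an element
below `a'`. In both kinds of effect algebra the sum of an element below a sharp `a` and an element
below `a'` is their join (`SharpSumsAreJoins`), and `a` splits the meet of two elements that it
splits (`SplitsInf`): under the Riesz Decomposition Property because `a` splits everything, in the
lattice case because addition distributes over meets. The rest of the proof uses only these two
facts and monotone σ-completeness. They imply that the elements split by `a` are closed under
orthosupplements, meets and suprema of increasing sequences, so that the bicommutant of the chain
`x t` among the sharp elements is a Boolean σ-algebra `S` with the operations of `E`
(`exists_isSigmaBlock`).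

It remains to extend `Iio t ↦ x t` to a σ-homomorphism from the Borel sets to `S`. Outer measures
do not help, for `S` need not be weakly distributive. Instead, the nonzero elements of `S` are used
as forcing conditions: a sufficiently generic filter `G` names a real number (`genericPoint`), and
the element attached to a Borel set `F` is the Boolean value of "the generic real lies in `F`", the
one `b ∈ S` such that, for every `G` meeting suitable countably many dense sets, the real lies in
`F` iff `b ∈ G` (`Realizes`). The Rasiowa–Sikorski lemma makes `b` unique and monotone in `F`, and
its existence follows by induction on Borel sets, genericity being what turns countable unions into
suprema. The hypotheses on `x` say that the half-line `Iio t` has the value `x t`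
(`Realizes.Iio`).

Uniqueness of the observable is a π-λ argument (`IsObservable.ext_of_Iio`).
-/

namespace EffectAlgebra

variable {E : Type*} [EffectAlgebra E]

/-! ### Arithmetic of the partial addition -/

theorem padd_swap {a b s : E} (h : padd a b = some s) : padd b a = some s := by
  rw [padd_comm, h]

theorem zero_padd (a : E) : padd 0 a = some a := padd_swap (padd_zero a)

theorem zero_le_elem (a : E) : 0 ≤ a := ⟨a, zero_padd a⟩

theorem le_one_elem (a : E) : a ≤ 1 := ⟨orthosupp a, padd_orthosupp a⟩

theorem eq_zero_of_le_zero {a : E} (h : a ≤ 0) : a = 0 := le_antisymm h (zero_le_elem a)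

theorem left_le_of_padd {a b s : E} (h : padd a b = some s) : a ≤ s := ⟨b, h⟩

theorem right_le_of_padd {a b s : E} (h : padd a b = some s) : b ≤ s := ⟨a, padd_swap h⟩

theorem eq_orthosupp_of_padd {a b : E} (h : padd a b = some 1) : b = orthosupp a :=
  (existsUnique_compl a).unique h (padd_orthosupp a)

@[simp]
theorem orthosupp_orthosupp (a : E) : orthosupp (orthosupp a) = a :=
  (eq_orthosupp_of_padd (padd_swap (padd_orthosupp a))).symm

@[simp]
theorem orthosupp_zero : orthosupp (0 : E) = 1 := (eq_orthosupp_of_padd (zero_padd 1)).symm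

theorem le_orthosupp_of_padd {a b s : E} (h : padd a b = some s) : b ≤ orthosupp a := by
  obtain ⟨u, hu, hau⟩ := assoc_right h (padd_orthosupp s)
  rw [← eq_orthosupp_of_padd hau]
  exact ⟨_, hu⟩

theorem exists_padd_of_le_orthosupp {a b : E} (h : b ≤ orthosupp a) : ∃ s, padd a b = some s := by
  obtain ⟨c, hc⟩ := h
  obtain ⟨s, hs, -⟩ := assoc_left hc (padd_orthosupp a)
  exact ⟨s, hs⟩

theorem le_orthosupp_comm {a b : E} : a ≤ orthosupp b ↔ b ≤ orthosupp a := by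
  constructor <;> intro h <;> obtain ⟨s, hs⟩ := exists_padd_of_le_orthosupp h <;>
    exact le_orthosupp_of_padd (padd_swap hs)

theorem orthosupp_anti {a b : E} (h : a ≤ b) : orthosupp b ≤ orthosupp a := by
  rw [le_orthosupp_comm, orthosupp_orthosupp]
  exact h

theorem orthosupp_le_comm {a b : E} : orthosupp a ≤ b ↔ orthosupp b ≤ a := by
  constructor <;> intro h <;> simpa using orthosupp_anti h

theorem orthosupp_le_orthosupp {a b : E} : orthosupp a ≤ orthosupp b ↔ b ≤ a := by
  rw [orthosupp_le_comm, orthosupp_orthosupp]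

theorem padd_le_padd_right {a a₁ b s₁ : E} (ha : a ≤ a₁) (h : padd a₁ b = some s₁) :
    ∃ s, padd a b = some s ∧ s ≤ s₁ := by
  obtain ⟨c, hc⟩ := ha
  obtain ⟨u, hu, hcu⟩ := assoc_right (padd_swap hc) h
  exact ⟨u, hu, right_le_of_padd hcu⟩

theorem padd_le_padd {a a₁ b b₁ s₁ : E} (ha : a ≤ a₁) (hb : b ≤ b₁) (h : padd a₁ b₁ = some s₁) :
    ∃ s, padd a b = some s ∧ s ≤ s₁ := by
  obtain ⟨t, ht, hts⟩ := padd_le_padd_right ha h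
  obtain ⟨s, hs, hst⟩ := padd_le_padd_right hb (padd_swap ht)
  exact ⟨s, padd_swap hs, hst.trans hts⟩

theorem sum_le_sum {a a₁ b b₁ s s₁ : E} (ha : a ≤ a₁) (hb : b ≤ b₁) (h : padd a b = some s)
    (h₁ : padd a₁ b₁ = some s₁) : s ≤ s₁ := by
  obtain ⟨t, ht, hts⟩ := padd_le_padd ha hb h₁
  rw [h] at ht
  exact Option.some_injective _ ht ▸ hts

theorem padd_padd_padd_comm {a b c d s t u : E} (hs : padd a b = some s) (ht : padd c d = some t)
    (hu : padd s t = some u) :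
    ∃ p q, padd a c = some p ∧ padd b d = some q ∧ padd p q = some u := by
  obtain ⟨v, hv, hav⟩ := assoc_right hs hu
  obtain ⟨w, hw, hwd⟩ := assoc_left ht hv
  obtain ⟨q, hq, hcq⟩ := assoc_right (padd_swap hw) hwd
  obtain ⟨p, hp, hpq⟩ := assoc_left hcq hav
  exact ⟨p, q, hp, hq, hpq⟩

theorem le_of_padd_le_padd_left {a b c s t : E} (hs : padd a b = some s) (ht : padd a c = some t)
    (h : s ≤ t) : b ≤ c := by
  obtain ⟨d, hd⟩ := h
  obtain ⟨e, he, hae⟩ := assoc_right hs hd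
  exact padd_left_cancel hae ht ▸ left_le_of_padd he

theorem padd_orthosupp_of_padd {a u v u' v' s : E} (hu : padd u u' = some a)
    (hv : padd v v' = some (orthosupp a)) (hs : padd u v = some s) :
    padd u' v' = some (orthosupp s) := by
  obtain ⟨p, q, hp, hq, hpq⟩ := padd_padd_padd_comm hu hv (padd_orthosupp a)
  obtain rfl : s = p := Option.some_injective _ (hs.symm.trans hp)
  rw [hq, eq_orthosupp_of_padd hpq]

theorem isLUB_pair_iff {a b s : E} :
    IsLUB {a, b} s ↔ a ≤ s ∧ b ≤ s ∧ ∀ w, a ≤ w → b ≤ w → s ≤ w := by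
  simp [IsLUB, IsLeast, mem_lowerBounds, and_assoc]

theorem isGLB_pair_iff {a b s : E} :
    IsGLB {a, b} s ↔ s ≤ a ∧ s ≤ b ∧ ∀ w, w ≤ a → w ≤ b → w ≤ s := by
  simp [IsGLB, IsGreatest, mem_upperBounds, and_assoc]

theorem isLUB_orthosupp_of_isGLB_pair {a b c : E} (h : IsGLB {orthosupp a, orthosupp b} c) :
    IsLUB {a, b} (orthosupp c) := by
  obtain ⟨h1, h2, h3⟩ := isGLB_pair_iff.1 h
  refine isLUB_pair_iff.2 ⟨le_orthosupp_comm.1 h1, le_orthosupp_comm.1 h2, fun w hw1 hw2 => ?_⟩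
  exact orthosupp_le_comm.1 (h3 _ (orthosupp_anti hw1) (orthosupp_anti hw2))

theorem isLUB_range_orthosupp {ι : Type*} {f : ι → E} {a : E} (h : IsGLB (Set.range f) a) :
    IsLUB (Set.range fun i => orthosupp (f i)) (orthosupp a) := by
  constructor
  · rintro _ ⟨i, rfl⟩
    exact orthosupp_anti (h.1 ⟨i, rfl⟩)
  · intro w hw
    refine orthosupp_le_comm.1 (h.2 ?_)
    rintro _ ⟨i, rfl⟩
    exact orthosupp_le_comm.1 (hw ⟨i, rfl⟩)

/-! ### Sharp elements and elements split by them -/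

theorem isSharp_iff {a : E} : IsSharp a ↔ ∀ y, y ≤ a → y ≤ orthosupp a → y = 0 := by
  rw [IsSharp, isGLB_pair_iff]
  exact ⟨fun h y h1 h2 => eq_zero_of_le_zero (h.2.2 y h1 h2),
    fun h => ⟨zero_le_elem _, zero_le_elem _, fun w h1 h2 => (h w h1 h2).le⟩⟩

theorem IsSharp.eq_zero {a y : E} (h : IsSharp a) (h1 : y ≤ a) (h2 : y ≤ orthosupp a) : y = 0 :=
  isSharp_iff.1 h y h1 h2

theorem IsSharp.orthosupp {a : E} (h : IsSharp a) : IsSharp (orthosupp a) :=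
  isSharp_iff.2 fun _ h1 h2 => h.eq_zero (by simpa using h2) h1

theorem isSharp_zero : IsSharp (0 : E) := isSharp_iff.2 fun _ h _ => eq_zero_of_le_zero h

/-- A sum of an element below a sharp `a` and an element below `a'` is the join of the two. This is
what lattice effect algebras and effect algebras with the Riesz Decomposition Property have in
common. -/
def SharpSumsAreJoins (E : Type*) [EffectAlgebra E] : Prop :=
  ∀ a u v s : E, IsSharp a → u ≤ a → v ≤ orthosupp a → padd u v = some s → IsLUB {u, v} s

/-- `a` splits `e` if `e` is a sum of an element below `a` and an element below `a'`; for sharp `a`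
the summands are the meets of `e` with `a` and `a'` (see `SharpSumsAreJoins.isGLB`), so that this is
the relation of compatibility, or commutation. -/
def Splits (a e : E) : Prop := ∃ e₁ e₂, e₁ ≤ a ∧ e₂ ≤ orthosupp a ∧ padd e₁ e₂ = some e

theorem splits_of_le {a e : E} (h : e ≤ a) : Splits a e :=
  ⟨e, 0, h, zero_le_elem _, padd_zero e⟩

theorem splits_zero (a : E) : Splits a 0 := splits_of_le (zero_le_elem a)

theorem Splits.symm {a e : E} (h : Splits a e) : Splits e a := by
  obtain ⟨e₁, e₂, h1, h2, h⟩ := h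
  obtain ⟨r, hr⟩ := h1
  refine ⟨e₁, r, left_le_of_padd h, ?_, hr⟩
  -- `a + e₂ = (r + e₁) + e₂ = r + e` is defined
  obtain ⟨t, ht⟩ := exists_padd_of_le_orthosupp h2
  obtain ⟨u, hu, hru⟩ := assoc_right (padd_swap hr) ht
  rw [h] at hu
  obtain rfl := Option.some_injective _ hu
  exact le_orthosupp_of_padd (padd_swap hru)

theorem Splits.orthosupp {a e : E} (h : Splits a e) : Splits a (orthosupp e) := by
  obtain ⟨e₁, e₂, ⟨f₁, h1⟩, ⟨f₂, h2⟩, h⟩ := h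
  exact ⟨f₁, f₂, right_le_of_padd h1, right_le_of_padd h2, padd_orthosupp_of_padd h1 h2 h⟩

namespace SharpSumsAreJoins

/-- The inequality `(u ∨ a') ∧ (a ∨ v) ≤ u ∨ v` for `u ≤ a` and `v ≤ a'`. -/
theorem le_padd (hQ : SharpSumsAreJoins E) {a u v s s₁ s₂ c : E} (ha : IsSharp a)
    (hu : u ≤ a) (hv : v ≤ orthosupp a) (hs : padd u v = some s)
    (h1 : padd u (orthosupp a) = some s₁) (h2 : padd a v = some s₂) (hc1 : c ≤ s₁) (hc2 : c ≤ s₂) :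
    c ≤ s := by
  obtain ⟨u', hu'⟩ := hu
  obtain ⟨v', hv'⟩ := hv
  have hs' := padd_orthosupp_of_padd hu' hv' hs
  have e1 := padd_orthosupp_of_padd hu' (padd_zero _) h1
  have e2 := padd_orthosupp_of_padd (padd_zero a) hv' h2
  rw [padd_zero, Option.some_inj] at e1
  rw [zero_padd, Option.some_inj] at e2
  have := (isLUB_pair_iff.1 (hQ a u' v' _ ha (right_le_of_padd hu') (right_le_of_padd hv') hs')).2.2
    (orthosupp c) (e1 ▸ orthosupp_anti hc1) (e2 ▸ orthosupp_anti hc2)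
  exact orthosupp_le_orthosupp.1 this

/-- If a sharp `a` splits `e`, then the summand below `a` is the meet of `e` and `a`. -/
theorem isGLB (hQ : SharpSumsAreJoins E) {a e e₁ e₂ : E} (ha : IsSharp a) (h1 : e₁ ≤ a)
    (h2 : e₂ ≤ orthosupp a) (h : padd e₁ e₂ = some e) : IsGLB {e, a} e₁ := by
  refine isGLB_pair_iff.2 ⟨left_le_of_padd h, h1, fun w hw1 hw2 => ?_⟩
  obtain ⟨s, hs⟩ := exists_padd_of_le_orthosupp (orthosupp_anti h1)
  exact hQ.le_padd ha h1 (zero_le_elem _) (padd_zero e₁) hs (padd_zero a)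
    (hw1.trans (sum_le_sum le_rfl h2 h hs)) hw2

theorem isSharp_inf (hQ : SharpSumsAreJoins E) {a e c : E} (ha : IsSharp a) (he : IsSharp e)
    (hae : Splits a e) (hc : IsGLB {e, a} c) : IsSharp c := by
  obtain ⟨e₁, e₂, h1, h2, h⟩ := hae
  obtain rfl := hc.unique (hQ.isGLB ha h1 h2 h)
  refine isSharp_iff.2 fun y hy hy' => ?_
  -- `c' = e₂ + e'`, and the part of it below `e` is `e₂`
  obtain ⟨u, hu, hcu⟩ := assoc_right h (padd_orthosupp e)
  rw [eq_orthosupp_of_padd hcu] at hu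
  have hye : y ≤ e₂ := (isGLB_pair_iff.1 (hQ.isGLB he (right_le_of_padd h) le_rfl hu)).2.2 y hy'
    (hy.trans (left_le_of_padd h))
  exact ha.eq_zero (hy.trans h1) (hye.trans h2)

theorem isSharp_of_isLUB (hQ : SharpSumsAreJoins E) {f : ℕ → E} {s : E} (hf : ∀ n, IsSharp (f n))
    (hs : IsLUB (Set.range f) s) : IsSharp s := by
  refine isSharp_iff.2 fun y hy hy' => ?_
  obtain ⟨g, hg⟩ := id hy
  -- `y + f n` is the join of `y` and `f n`, so it lies below `s = y + g`
  have hfg : s ≤ g := by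
    refine hs.2 ?_
    rintro _ ⟨n, rfl⟩
    have hns : f n ≤ s := hs.1 ⟨n, rfl⟩
    have hyn : y ≤ orthosupp (f n) := hy'.trans (orthosupp_anti hns)
    obtain ⟨t, ht⟩ := exists_padd_of_le_orthosupp hyn
    exact le_of_padd_le_padd_left (padd_swap ht) hg
      ((isLUB_pair_iff.1 (hQ _ _ _ _ (hf n) le_rfl hyn ht)).2.2 s hns hy)
  obtain rfl := le_antisymm hfg (right_le_of_padd hg)
  exact padd_left_cancel (padd_swap hg) (padd_zero s)

theorem splits_of_isLUB (hQ : SharpSumsAreJoins E) (hE : IsMonotoneSigmaComplete E) {a : E}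
    (ha : IsSharp a) {f : ℕ → E} {s : E} (hmono : ∀ n, f n ≤ f (n + 1)) (hf : ∀ n, Splits a (f n))
    (hs : IsLUB (Set.range f) s) : Splits a s := by
  choose f₁ f₂ h1 h2 h using hf
  have hm1 : ∀ n, f₁ n ≤ f₁ (n + 1) := fun n =>
    (isGLB_pair_iff.1 (hQ.isGLB ha (h1 _) (h2 _) (h (n + 1)))).2.2 _
      ((left_le_of_padd (h n)).trans (hmono n)) (h1 n)
  have hm2 : ∀ n, f₂ n ≤ f₂ (n + 1) := fun n =>
    (isGLB_pair_iff.1 (hQ.isGLB ha.orthosupp (h2 _) (by simpa using h1 _)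
      (padd_swap (h (n + 1))))).2.2 _ ((right_le_of_padd (h n)).trans (hmono n)) (h2 n)
  obtain ⟨s₁, hs1⟩ := hE f₁ hm1
  obtain ⟨s₂, hs2⟩ := hE f₂ hm2
  have hs1a : s₁ ≤ a := hs1.2 (by rintro _ ⟨n, rfl⟩; exact h1 n)
  have hs2a : s₂ ≤ orthosupp a := hs2.2 (by rintro _ ⟨n, rfl⟩; exact h2 n)
  obtain ⟨t, ht⟩ := exists_padd_of_le_orthosupp (hs2a.trans (orthosupp_anti hs1a))
  have hlub : IsLUB (Set.range f) t := by
    refine ⟨?_, fun w hw => ?_⟩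
    · rintro _ ⟨n, rfl⟩
      exact sum_le_sum (hs1.1 ⟨n, rfl⟩) (hs2.1 ⟨n, rfl⟩) (h n) ht
    · refine (isLUB_pair_iff.1 (hQ a _ _ _ ha hs1a hs2a ht)).2.2 w (hs1.2 ?_) (hs2.2 ?_)
      · rintro _ ⟨n, rfl⟩
        exact (left_le_of_padd (h n)).trans (hw ⟨n, rfl⟩)
      · rintro _ ⟨n, rfl⟩
        exact (right_le_of_padd (h n)).trans (hw ⟨n, rfl⟩)
  exact ⟨s₁, s₂, hs1a, hs2a, hs.unique hlub ▸ ht⟩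

end SharpSumsAreJoins

/-- Every sharp element that splits two elements splits their meet. -/
def SplitsInf (E : Type*) [EffectAlgebra E] : Prop :=
  ∀ a b e c : E, IsSharp a → Splits a b → Splits a e → IsGLB {b, e} c → Splits a c

/-! ### Effect algebras with the Riesz Decomposition Property -/

theorem HasRDP.splits (hR : HasRDP E) (a e : E) : Splits a e := by
  obtain ⟨c₁₁, c₁₂, c₂₁, c₂₂, h1, -, h3, h4⟩ :=
    hR e (orthosupp e) a (orthosupp a) 1 (padd_orthosupp e) (padd_orthosupp a)
  exact ⟨c₁₁, c₁₂, left_le_of_padd h3, left_le_of_padd h4, h1⟩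

theorem HasRDP.le_of_le_padd (hR : HasRDP E) {a u w w₁ w₂ : E} (ha : IsSharp a) (hu : u ≤ a)
    (hw2 : w₂ ≤ orthosupp a) (hw : padd w₁ w₂ = some w) (huw : u ≤ w) : u ≤ w₁ := by
  obtain ⟨r, hr⟩ := huw
  obtain ⟨c₁₁, c₁₂, c₂₁, c₂₂, h1, -, h3, h4⟩ := hR _ _ _ _ _ hr hw
  have h0 : c₁₂ = 0 :=
    ha.eq_zero ((right_le_of_padd h1).trans hu) ((left_le_of_padd h4).trans hw2)
  rw [h0, padd_zero, Option.some_inj] at h1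
  exact h1 ▸ left_le_of_padd h3

theorem HasRDP.sharpSumsAreJoins (hR : HasRDP E) : SharpSumsAreJoins E := by
  intro a u v s ha hu hv hs
  refine isLUB_pair_iff.2 ⟨left_le_of_padd hs, right_le_of_padd hs, fun w huw hvw => ?_⟩
  obtain ⟨w₁, w₂, h1, h2, h⟩ := hR.splits a w
  exact sum_le_sum (hR.le_of_le_padd ha hu h2 h huw)
    (hR.le_of_le_padd ha.orthosupp hv (by simpa using h1) (padd_swap h) hvw) hs h

theorem HasRDP.splitsInf (hR : HasRDP E) : SplitsInf E := fun a _ _ c _ _ _ _ => hR.splits a c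

/-! ### Lattice effect algebras -/

theorem IsSigmaLattice.exists_isLUB_pair (hL : IsSigmaLattice E) (a b : E) :
    ∃ s, IsLUB {a, b} s := by
  obtain ⟨s, hs⟩ := (hL fun n => if n = 0 then a else b).1
  refine ⟨s, isLUB_pair_iff.2 ⟨hs.1 ⟨0, rfl⟩, hs.1 ⟨1, rfl⟩, fun w ha hb => hs.2 ?_⟩⟩
  rintro _ ⟨n, rfl⟩
  dsimp only
  split_ifs <;> assumption

theorem IsSigmaLattice.exists_isGLB_pair (hL : IsSigmaLattice E) (a b : E) :
    ∃ s, IsGLB {a, b} s := by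
  obtain ⟨s, hs⟩ := hL.exists_isLUB_pair (orthosupp a) (orthosupp b)
  obtain ⟨h1, h2, h3⟩ := isLUB_pair_iff.1 hs
  refine ⟨orthosupp s, isGLB_pair_iff.2 ⟨orthosupp_le_comm.1 h1, orthosupp_le_comm.1 h2,
    fun w ha hb => le_orthosupp_comm.1 (h3 _ (orthosupp_anti ha) (orthosupp_anti hb))⟩⟩

theorem IsSigmaLattice.sharpSumsAreJoins (hL : IsSigmaLattice E) : SharpSumsAreJoins E := by
  intro a u v s ha hu hv hs
  obtain ⟨j, hj⟩ := hL.exists_isLUB_pair u v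
  obtain ⟨h1, h2, h3⟩ := isLUB_pair_iff.1 hj
  obtain ⟨d, hd⟩ := h3 s (left_le_of_padd hs) (right_le_of_padd hs)
  -- the gap `d` between the join and the sum lies below both `u` and `v`
  have key : ∀ u v : E, padd u v = some s → u ≤ j → d ≤ v := by
    rintro u v hs ⟨g, hg⟩
    obtain ⟨e, he, hue⟩ := assoc_right hg hd
    exact padd_left_cancel hue hs ▸ right_le_of_padd he
  have hd0 : d = 0 :=
    ha.eq_zero ((key v u (padd_swap hs) h2).trans hu) ((key u v hs h1).trans hv)
  rw [hd0, padd_zero, Option.some_inj] at hd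
  exact hd ▸ hj

/-- Addition of a fixed element preserves binary meets. -/
theorem IsSigmaLattice.le_padd_of_isGLB (hL : IsSigmaLattice E) {a b p z s t r c : E}
    (hp : IsGLB {a, b} p) (hs : padd a z = some s) (ht : padd b z = some t)
    (hr : padd p z = some r) (hcs : c ≤ s) (hct : c ≤ t) : c ≤ r := by
  obtain ⟨j, hj⟩ := hL.exists_isLUB_pair c z
  obtain ⟨h1, ⟨k, hk⟩, h3⟩ := isLUB_pair_iff.1 hj
  have hka := le_of_padd_le_padd_left hk (padd_swap hs) (h3 s hcs (right_le_of_padd hs))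
  have hkb := le_of_padd_le_padd_left hk (padd_swap ht) (h3 t hct (right_le_of_padd ht))
  exact h1.trans (sum_le_sum le_rfl ((isGLB_pair_iff.1 hp).2.2 k hka hkb) hk (padd_swap hr))

theorem IsSigmaLattice.splitsInf (hL : IsSigmaLattice E) : SplitsInf E := by
  intro a b e c ha hb he hc
  have hQ := hL.sharpSumsAreJoins
  obtain ⟨b₁, b₂, hb1, hb2, hb⟩ := hb
  obtain ⟨e₁, e₂, he1, he2, he⟩ := he
  obtain ⟨hcb, hce, hc3⟩ := isGLB_pair_iff.1 hc
  obtain ⟨p, hp⟩ := hL.exists_isGLB_pair b₁ e₁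
  obtain ⟨q, hq⟩ := hL.exists_isGLB_pair b₂ e₂
  have hp' := isGLB_pair_iff.1 hp
  have hq' := isGLB_pair_iff.1 hq
  have hdef : ∀ {u v : E}, u ≤ a → v ≤ orthosupp a → ∃ s, padd u v = some s := fun hu hv =>
    exists_padd_of_le_orthosupp (hv.trans (orthosupp_anti hu))
  obtain ⟨r, hr⟩ := hdef (hp'.1.trans hb1) (hq'.1.trans hb2)
  -- `c` lies below all four sums of a summand of `b` or `e` below `a` and one below `a'`
  have hmix : ∀ {x₁ x₂ x y₁ y₂ y s : E}, x₁ ≤ a → x₂ ≤ orthosupp a → padd x₁ x₂ = some x →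
      y₁ ≤ a → y₂ ≤ orthosupp a → padd y₁ y₂ = some y → c ≤ x → c ≤ y →
      padd x₁ y₂ = some s → c ≤ s := by
    intro x₁ x₂ x y₁ y₂ y s hx1 hx2 hx hy1 hy2 hy hcx hcy hs
    obtain ⟨s₁, hs1⟩ := hdef hx1 le_rfl
    obtain ⟨s₂, hs2⟩ := hdef le_rfl hy2
    exact hQ.le_padd ha hx1 hy2 hs hs1 hs2 (hcx.trans (sum_le_sum le_rfl hx2 hx hs1))
      (hcy.trans (sum_le_sum hy1 le_rfl hy hs2))
  obtain ⟨m, hm⟩ := hdef hb1 he2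
  obtain ⟨n, hn⟩ := hdef he1 hb2
  obtain ⟨pb, hpb⟩ := hdef (hp'.1.trans hb1) hb2
  obtain ⟨pe, hpe⟩ := hdef (hp'.1.trans hb1) he2
  have hc_pb : c ≤ pb := hL.le_padd_of_isGLB hp hb hn hpb hcb
    (hmix he1 he2 he hb1 hb2 hb hce hcb hn)
  have hc_pe : c ≤ pe := hL.le_padd_of_isGLB hp hm he hpe
    (hmix hb1 hb2 hb he1 he2 he hcb hce hm) hce
  have hcr : c ≤ r := hL.le_padd_of_isGLB hq (padd_swap hpb) (padd_swap hpe) (padd_swap hr)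
    hc_pb hc_pe
  have hrc : r ≤ c := hc3 r (sum_le_sum hp'.1 hq'.1 hr hb) (sum_le_sum hp'.2.1 hq'.2.1 hr he)
  exact ⟨p, q, hp'.1.trans hb1, hq'.1.trans hb2, le_antisymm hcr hrc ▸ hr⟩

/-! ### Boolean σ-blocks of sharp elements -/

/-- A set of sharp elements that split one another, closed under orthosupplements, binary meets and
suprema of increasing sequences, all taken in `E`: a Boolean σ-algebra whose countable operations
are those of `E`. -/
structure IsSigmaBlock (S : Set E) : Prop where
  isSharp : ∀ a ∈ S, IsSharp a
  zero_mem : 0 ∈ S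
  orthosupp_mem : ∀ a ∈ S, orthosupp a ∈ S
  splits : ∀ a ∈ S, ∀ b ∈ S, Splits a b
  exists_isGLB : ∀ a ∈ S, ∀ b ∈ S, ∃ c ∈ S, IsGLB {a, b} c
  exists_isLUB_of_mono : ∀ f : ℕ → E, (∀ n, f n ≤ f (n + 1)) → (∀ n, f n ∈ S) →
    ∃ s ∈ S, IsLUB (Set.range f) s

/-- A chain of sharp elements lies in a σ-block, namely its bicommutant for the relation
`Splits`. -/
theorem exists_isSigmaBlock (hQ : SharpSumsAreJoins E) (hM : SplitsInf E)
    (hE : IsMonotoneSigmaComplete E) {ι : Type*} [LinearOrder ι] {x : ι → E} (hx : Monotone x)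
    (hsharp : ∀ t, IsSharp (x t)) : ∃ S : Set E, IsSigmaBlock S ∧ ∀ t, x t ∈ S := by
  have hxx : ∀ t s, Splits (x t) (x s) := fun t s => by
    rcases le_total s t with h | h
    · exact splits_of_le (hx h)
    · exact (splits_of_le (hx h)).symm
  let S : Set E := {e | IsSharp e ∧ ∀ b, IsSharp b → (∀ t, Splits b (x t)) → Splits b e}
  have hS : ∀ a ∈ S, ∀ b ∈ S, Splits a b := fun a ha b hb =>
    hb.2 a ha.1 fun t => (ha.2 (x t) (hsharp t) (hxx t)).symm
  refine ⟨S, ⟨fun a ha => ha.1, ⟨isSharp_zero, fun b _ _ => splits_zero b⟩,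
    fun a ha => ⟨ha.1.orthosupp, fun b hb h => (ha.2 b hb h).orthosupp⟩, hS, ?_, ?_⟩,
    fun t => ⟨hsharp t, fun b _ h => h t⟩⟩
  · intro a ha b hb
    obtain ⟨c, c', h1, h2, h⟩ := hS b hb a ha
    have hc := hQ.isGLB hb.1 h1 h2 h
    exact ⟨c, ⟨hQ.isSharp_inf hb.1 ha.1 (hS b hb a ha) hc, fun d hd hdx =>
      hM d a b c hd (ha.2 d hd hdx) (hb.2 d hd hdx) hc⟩, hc⟩
  · intro f hf hfS
    obtain ⟨s, hs⟩ := hE f hf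
    exact ⟨s, ⟨hQ.isSharp_of_isLUB (fun n => (hfS n).1) hs, fun b hb hbx =>
      hQ.splits_of_isLUB hE hb hf (fun n => (hfS n).2 b hb hbx) hs⟩, hs⟩

namespace IsSigmaBlock

variable {S : Set E}

theorem exists_isLUB_pair (hS : IsSigmaBlock S) {a b : E} (ha : a ∈ S) (hb : b ∈ S) :
    ∃ c ∈ S, IsLUB {a, b} c := by
  obtain ⟨c, hc, h⟩ := hS.exists_isGLB _ (hS.orthosupp_mem a ha) _ (hS.orthosupp_mem b hb)
  exact ⟨orthosupp c, hS.orthosupp_mem c hc, isLUB_orthosupp_of_isGLB_pair h⟩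

theorem exists_isLUB (hS : IsSigmaBlock S) {f : ℕ → E} (hf : ∀ n, f n ∈ S) :
    ∃ s ∈ S, IsLUB (Set.range f) s := by
  choose j hjS hj using fun a b : S => hS.exists_isLUB_pair a.2 b.2
  let g : ℕ → S := fun n =>
    Nat.rec ⟨f 0, hf 0⟩ (fun k a => ⟨j a ⟨f (k + 1), hf (k + 1)⟩, hjS _ _⟩) n
  have hg : ∀ n, IsLUB {(g n).1, f (n + 1)} (g (n + 1)).1 := fun n => hj (g n) ⟨f (n + 1), _⟩
  obtain ⟨s, hsS, hs⟩ := hS.exists_isLUB_of_mono (fun n => (g n).1)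
    (fun n => (isLUB_pair_iff.1 (hg n)).1) fun n => (g n).2
  refine ⟨s, hsS, ?_, fun w hw => hs.2 ?_⟩
  · rintro _ ⟨n, rfl⟩
    refine le_trans ?_ (hs.1 ⟨n, rfl⟩)
    cases n with
    | zero => exact le_rfl
    | succ n => exact (isLUB_pair_iff.1 (hg n)).2.1
  · rintro _ ⟨n, rfl⟩
    induction n with
    | zero => exact hw ⟨0, rfl⟩
    | succ n ih => exact (isLUB_pair_iff.1 (hg n)).2.2 w ih (hw ⟨n + 1, rfl⟩)

theorem le_orthosupp_or_exists (hS : IsSigmaBlock S) {p b : E} (hp : p ∈ S) (hb : b ∈ S) :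
    p ≤ orthosupp b ∨ ∃ d ∈ S, d ≠ 0 ∧ d ≤ p ∧ d ≤ b := by
  obtain ⟨c, hcS, hc⟩ := hS.exists_isGLB p hp b hb
  obtain ⟨h1, h2, h3⟩ := isGLB_pair_iff.1 hc
  by_cases h0 : c = 0
  · left
    obtain ⟨e₁, e₂, he1, he2, he⟩ := hS.splits b hb p hp
    have : e₁ = 0 := eq_zero_of_le_zero (h0 ▸ h3 e₁ (left_le_of_padd he) he1)
    rw [this, zero_padd, Option.some_inj] at he
    exact he ▸ he2
  · exact Or.inr ⟨c, hcS, h0, h1, h2⟩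

end IsSigmaBlock

/-! ### Generic filters -/

/-- `D` is dense for forcing with the nonzero elements of `S`. -/
def IsDenseIn (S D : Set E) : Prop := ∀ p ∈ S, p ≠ 0 → ∃ d ∈ S, d ≠ 0 ∧ d ≤ p ∧ d ∈ D

/-- `G` is a proper filter of `E` that meets every member of the family `𝒟`. -/
structure IsGeneric (𝒟 : Set (Set E)) (G : Set E) : Prop where
  nonempty : G.Nonempty
  mem_of_le : ∀ {a b}, a ∈ G → a ≤ b → b ∈ G
  exists_le : ∀ {a b}, a ∈ G → b ∈ G → ∃ c ∈ G, c ≤ a ∧ c ≤ b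
  zero_notMem : 0 ∉ G
  exists_mem : ∀ D ∈ 𝒟, ∃ d ∈ D, d ∈ G

namespace IsGeneric

variable {𝒟 : Set (Set E)} {G : Set E}

theorem anti (hG : IsGeneric 𝒟 G) {𝒟' : Set (Set E)} (h : 𝒟' ⊆ 𝒟) : IsGeneric 𝒟' G :=
  { hG with exists_mem := fun D hD => hG.exists_mem D (h hD) }

theorem one_mem (hG : IsGeneric 𝒟 G) : 1 ∈ G := by
  obtain ⟨a, ha⟩ := hG.nonempty
  exact hG.mem_of_le ha (le_one_elem a)

theorem orthosupp_notMem (hG : IsGeneric 𝒟 G) {a : E} (ha : IsSharp a) (haG : a ∈ G) :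
    orthosupp a ∉ G := fun h => by
  obtain ⟨c, hcG, h1, h2⟩ := hG.exists_le haG h
  exact hG.zero_notMem (ha.eq_zero h1 h2 ▸ hcG)

theorem inf_mem_iff (hG : IsGeneric 𝒟 G) {a b c : E} (hc : IsGLB {a, b} c) :
    c ∈ G ↔ a ∈ G ∧ b ∈ G := by
  obtain ⟨h1, h2, h3⟩ := isGLB_pair_iff.1 hc
  refine ⟨fun h => ⟨hG.mem_of_le h h1, hG.mem_of_le h h2⟩, fun ⟨ha, hb⟩ => ?_⟩
  obtain ⟨d, hd, hda, hdb⟩ := hG.exists_le ha hb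
  exact hG.mem_of_le hd (h3 d hda hdb)

end IsGeneric

/-- The Rasiowa–Sikorski lemma: every nonzero element of `S` lies in a generic filter. -/
theorem exists_isGeneric {S : Set E} {𝒟 : Set (Set E)} (hc : 𝒟.Countable)
    (hd : ∀ D ∈ 𝒟, IsDenseIn S D) {p : E} (hp : p ∈ S) (hp0 : p ≠ 0) :
    ∃ G, IsGeneric 𝒟 G ∧ p ∈ G := by
  let P := {e : E // e ∈ S ∧ e ≠ 0}
  have := hc.toEncodable
  -- ideals of the dual order are filters, and cofinal sets there are dense sets
  let C : 𝒟 → Order.Cofinal Pᵒᵈ := fun D =>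
    ⟨{q | (OrderDual.ofDual q).1 ∈ D.1}, fun q => by
      obtain ⟨d, hdS, hd0, hdq, hdD⟩ := hd D.1 D.2 _ (OrderDual.ofDual q).2.1
        (OrderDual.ofDual q).2.2
      exact ⟨OrderDual.toDual ⟨d, hdS, hd0⟩, hdD, hdq⟩⟩
  let I := Order.idealOfCofinals (OrderDual.toDual (⟨p, hp, hp0⟩ : P)) C
  refine ⟨{e | ∃ q ∈ I, (OrderDual.ofDual q).1 ≤ e}, ?_,
    ⟨_, Order.mem_idealOfCofinals _ C, le_rfl⟩⟩
  refine ⟨⟨p, _, Order.mem_idealOfCofinals _ C, le_rfl⟩, ?_, ?_, ?_, ?_⟩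
  · rintro a b ⟨q, hq, hqa⟩ hab
    exact ⟨q, hq, hqa.trans hab⟩
  · rintro a b ⟨q, hq, hqa⟩ ⟨r, hr, hrb⟩
    obtain ⟨s, hs, hqs, hrs⟩ := I.directed q hq r hr
    exact ⟨(OrderDual.ofDual s).1, ⟨s, hs, le_rfl⟩, le_trans (b := (OrderDual.ofDual q).1) hqs hqa,
      le_trans (b := (OrderDual.ofDual r).1) hrs hrb⟩
  · rintro ⟨q, -, hq⟩
    exact (OrderDual.ofDual q).2.2 (eq_zero_of_le_zero hq)
  · intro D hD
    obtain ⟨q, hqD, hqI⟩ := Order.cofinal_meets_idealOfCofinals (OrderDual.toDual ⟨p, hp, hp0⟩) C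
      ⟨D, hD⟩
    exact ⟨(OrderDual.ofDual q).1, hqD, q, hqI, le_rfl⟩

/-- The elements that force the join `b` of the family `f` to hold through one of the `f i`, or to
fail. -/
def decidingJoin {ι : Type*} (f : ι → E) (b : E) : Set E := {d | (∃ i, d ≤ f i) ∨ d ≤ orthosupp b}

theorem IsSigmaBlock.isDenseIn_decidingJoin {S : Set E} (hS : IsSigmaBlock S) {ι : Type*}
    {f : ι → E} {b : E} (hf : ∀ i, f i ∈ S) (hb : IsLUB (Set.range f) b) :
    IsDenseIn S (decidingJoin f b) := by
  intro p hp hp0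
  by_cases h : ∃ i, ∃ d ∈ S, d ≠ 0 ∧ d ≤ p ∧ d ≤ f i
  · obtain ⟨i, d, hdS, hd0, hdp, hdi⟩ := h
    exact ⟨d, hdS, hd0, hdp, Or.inl ⟨i, hdi⟩⟩
  · push Not at h
    refine ⟨p, hp, hp0, le_rfl, Or.inr (le_orthosupp_comm.1 (hb.2 ?_))⟩
    rintro _ ⟨i, rfl⟩
    refine le_orthosupp_comm.1 ((hS.le_orthosupp_or_exists hp (hf i)).resolve_right ?_)
    rintro ⟨d, hdS, hd0, hdp, hdi⟩
    exact h i d hdS hd0 hdp hdi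

theorem IsGeneric.mem_iff_of_decidingJoin {𝒟 : Set (Set E)} {G : Set E} (hG : IsGeneric 𝒟 G)
    {ι : Type*} {f : ι → E} {b : E} (hb : IsLUB (Set.range f) b) (hbs : IsSharp b)
    (hD : decidingJoin f b ∈ 𝒟) : b ∈ G ↔ ∃ i, f i ∈ G := by
  refine ⟨fun h => ?_, fun ⟨i, hi⟩ => hG.mem_of_le hi (hb.1 ⟨i, rfl⟩)⟩
  obtain ⟨d, ⟨i, hi⟩ | hd, hdG⟩ := hG.exists_mem _ hD
  · exact ⟨i, hG.mem_of_le hdG hi⟩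
  · exact absurd (hG.mem_of_le hdG hd) (hG.orthosupp_notMem hbs h)

/-- For a one-term family, genericity decides membership of `b` itself. -/
theorem IsGeneric.orthosupp_mem_iff {𝒟 : Set (Set E)} {G : Set E} (hG : IsGeneric 𝒟 G) {b : E}
    (hbs : IsSharp b) (hD : decidingJoin (fun _ : Unit => b) b ∈ 𝒟) :
    orthosupp b ∈ G ↔ b ∉ G := by
  refine ⟨fun h hb => hG.orthosupp_notMem hbs hb h, fun h => ?_⟩
  obtain ⟨d, ⟨i, hi⟩ | hd, hdG⟩ := hG.exists_mem _ hD
  · exact absurd (hG.mem_of_le hdG hi) h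
  · exact hG.mem_of_le hdG hd

theorem isLUB_range_const {ι : Type*} [Nonempty ι] (b : E) :
    IsLUB (Set.range fun _ : ι => b) b := by
  simp

/-! ### The element of the block attached to a Borel set -/

/-- The real number named by a filter `G`: the cut between the `r` with `x r ∉ G` and those with
`x r ∈ G`. It is a junk value unless `G` is sufficiently generic. -/
noncomputable def genericPoint (x : ℝ → E) (G : Set E) : ℝ := sSup {r | orthosupp (x r) ∈ G}

/-- `b` is the Boolean value of the statement that the generic real lies in `F`: countably many
dense sets suffice for every generic `G` to satisfy `genericPoint x G ∈ F ↔ b ∈ G`. -/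
def Realizes (S : Set E) (x : ℝ → E) (F : Set ℝ) (b : E) : Prop :=
  b ∈ S ∧ ∃ 𝒟 : Set (Set E), 𝒟.Countable ∧ (∀ D ∈ 𝒟, IsDenseIn S D) ∧
    ∀ G, IsGeneric 𝒟 G → (genericPoint x G ∈ F ↔ b ∈ G)

namespace Realizes

variable {S : Set E} {x : ℝ → E}

theorem le_of_subset (hS : IsSigmaBlock S) {F F' : Set ℝ} {b b' : E} (h : Realizes S x F b)
    (h' : Realizes S x F' b') (hF : F ⊆ F') : b ≤ b' := by
  obtain ⟨hb, 𝒟, hc, hd, hR⟩ := h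
  obtain ⟨hb', 𝒟', hc', hd', hR'⟩ := h'
  rcases hS.le_orthosupp_or_exists hb (hS.orthosupp_mem _ hb') with hle | ⟨d, hdS, hd0, hdb, hdb'⟩
  · simpa using hle
  · obtain ⟨G, hG, hdG⟩ := exists_isGeneric (hc.union hc')
      (fun D hD => hD.elim (hd D) (hd' D)) hdS hd0
    have h1 := (hR G (hG.anti Set.subset_union_left)).2 (hG.mem_of_le hdG hdb)
    have h2 := (hR' G (hG.anti Set.subset_union_right)).1 (hF h1)
    exact absurd (hG.mem_of_le hdG hdb') (hG.orthosupp_notMem (hS.isSharp _ hb') h2)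

theorem unique (hS : IsSigmaBlock S) {F : Set ℝ} {b b' : E} (h : Realizes S x F b)
    (h' : Realizes S x F b') : b = b' :=
  le_antisymm (h.le_of_subset hS h' subset_rfl) (h'.le_of_subset hS h subset_rfl)

theorem empty (hS : IsSigmaBlock S) : Realizes S x ∅ 0 :=
  ⟨hS.zero_mem, ∅, Set.countable_empty, by simp, fun G hG => by simp [hG.zero_notMem]⟩

theorem compl (hS : IsSigmaBlock S) {F : Set ℝ} {b : E} (h : Realizes S x F b) :
    Realizes S x Fᶜ (orthosupp b) := by
  obtain ⟨hb, 𝒟, hc, hd, hR⟩ := h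
  refine ⟨hS.orthosupp_mem b hb, insert (decidingJoin (fun _ : Unit => b) b) 𝒟, hc.insert _, ?_,
    fun G hG => ?_⟩
  · rintro D (rfl | hD)
    · exact hS.isDenseIn_decidingJoin (fun _ => hb) (isLUB_range_const b)
    · exact hd D hD
  · rw [hG.orthosupp_mem_iff (hS.isSharp b hb) (Set.mem_insert _ _), Set.mem_compl_iff,
      hR G (hG.anti (Set.subset_insert _ _))]

theorem univ (hS : IsSigmaBlock S) : Realizes S x Set.univ 1 := by
  simpa using (empty (x := x) hS).compl hS

theorem inter (hS : IsSigmaBlock S) {F F' : Set ℝ} {b b' : E} (h : Realizes S x F b)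
    (h' : Realizes S x F' b') : ∃ c, Realizes S x (F ∩ F') c ∧ IsGLB {b, b'} c := by
  obtain ⟨hb, 𝒟, hc, hd, hR⟩ := h
  obtain ⟨hb', 𝒟', hc', hd', hR'⟩ := h'
  obtain ⟨c, hcS, hglb⟩ := hS.exists_isGLB b hb b' hb'
  refine ⟨c, ⟨hcS, 𝒟 ∪ 𝒟', hc.union hc', fun D hD => hD.elim (hd D) (hd' D), fun G hG => ?_⟩, hglb⟩
  rw [Set.mem_inter_iff, hR G (hG.anti Set.subset_union_left),
    hR' G (hG.anti Set.subset_union_right), hG.inf_mem_iff hglb]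

theorem union (hS : IsSigmaBlock S) {F F' : Set ℝ} {b b' : E} (h : Realizes S x F b)
    (h' : Realizes S x F' b') : ∃ c, Realizes S x (F ∪ F') c ∧ IsLUB {b, b'} c := by
  obtain ⟨c, hc, hglb⟩ := (h.compl hS).inter hS (h'.compl hS)
  refine ⟨orthosupp c, ?_, isLUB_orthosupp_of_isGLB_pair hglb⟩
  simpa [Set.compl_inter] using hc.compl hS

theorem iUnion (hS : IsSigmaBlock S) {F : ℕ → Set ℝ} {b : ℕ → E}
    (h : ∀ n, Realizes S x (F n) (b n)) :
    ∃ c, Realizes S x (⋃ n, F n) c ∧ IsLUB (Set.range b) c := by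
  choose hb 𝒟 hc hd hR using h
  obtain ⟨c, hcS, hlub⟩ := hS.exists_isLUB hb
  refine ⟨c, ⟨hcS, insert (decidingJoin b c) (⋃ n, 𝒟 n), (Set.countable_iUnion hc).insert _, ?_,
    fun G hG => ?_⟩, hlub⟩
  · rintro D (rfl | hD)
    · exact hS.isDenseIn_decidingJoin hb hlub
    · obtain ⟨n, hn⟩ := Set.mem_iUnion.1 hD
      exact hd n D hn
  · rw [hG.mem_iff_of_decidingJoin hlub (hS.isSharp c hcS) (Set.mem_insert _ _), Set.mem_iUnion]
    exact exists_congr fun n =>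
      hR n G (hG.anti ((Set.subset_iUnion 𝒟 n).trans (Set.subset_insert _ _)))

theorem Iio (hS : IsSigmaBlock S) (hxS : ∀ t, x t ∈ S) (hmono : Monotone x)
    (hinf : IsGLB (Set.range x) 0) (hsup : IsLUB (Set.range x) 1)
    (hleft : ∀ s : ℝ, IsLUB (x '' Set.Iio s) (x s)) (t : ℝ) :
    Realizes S x (Set.Iio t) (x t) := by
  have hbot : IsLUB (Set.range fun r => orthosupp (x r)) (1 : E) := by
    simpa using isLUB_range_orthosupp hinf
  have hlt : IsLUB (Set.range fun r : Set.Iio t => x r) (x t) := by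
    simpa [Set.image_eq_range] using hleft t
  have h1 : IsSharp (1 : E) := by simpa using (isSharp_zero (E := E)).orthosupp
  refine ⟨hxS t, {decidingJoin x 1, decidingJoin (fun r => orthosupp (x r)) 1,
    decidingJoin (fun _ : Unit => x t) (x t), decidingJoin (fun r : Set.Iio t => x r) (x t)},
    by simp, ?_, fun G hG => ?_⟩
  · rintro D (rfl | rfl | rfl | rfl)
    · exact hS.isDenseIn_decidingJoin hxS hsup
    · exact hS.isDenseIn_decidingJoin (fun r => hS.orthosupp_mem _ (hxS r)) hbot
    · exact hS.isDenseIn_decidingJoin (fun _ => hxS t) (isLUB_range_const _)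
    · exact hS.isDenseIn_decidingJoin (fun r => hxS r) hlt
  · -- a value `r` below the cut is smaller than any `s` above it
    have hcut : ∀ {s r}, x s ∈ G → orthosupp (x r) ∈ G → r < s := fun {s r} hs hr => by
      by_contra! hsr
      exact hG.orthosupp_notMem (hS.isSharp _ (hxS r)) (hG.mem_of_le hs (hmono hsr)) hr
    obtain ⟨M, hM⟩ := (hG.mem_iff_of_decidingJoin hsup h1 (by simp)).1 hG.one_mem
    obtain ⟨m, hm⟩ := (hG.mem_iff_of_decidingJoin hbot h1 (by simp)).1 hG.one_mem
    have hbdd : BddAbove {r | orthosupp (x r) ∈ G} := ⟨M, fun r hr => (hcut hM hr).le⟩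
    rw [Set.mem_Iio, genericPoint]
    constructor
    · intro h
      by_contra hn
      exact h.not_ge (le_csSup hbdd
        ((hG.orthosupp_mem_iff (hS.isSharp _ (hxS t)) (by simp)).2 hn))
    · intro h
      obtain ⟨⟨s, hst⟩, hs⟩ := (hG.mem_iff_of_decidingJoin hlt (hS.isSharp _ (hxS t)) (by simp)).1 h
      exact (csSup_le ⟨m, hm⟩ fun r hr => (hcut hs hr).le).trans_lt hst

end Realizes

/-! ### Observables -/

namespace IsObservable

variable {X Y : BorelSets → E}

theorem map_empty (hX : IsObservable X) : X ⟨∅, .empty⟩ = 0 := by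
  have h := hX.map_union ⟨∅, .empty⟩ ⟨∅, .empty⟩ (by simp)
  simp only [Set.union_self] at h
  exact padd_left_cancel h (padd_zero _)

theorem map_compl (hX : IsObservable X) (F : BorelSets) :
    X ⟨F.1ᶜ, F.2.compl⟩ = orthosupp (X F) := by
  have h := hX.map_union F ⟨F.1ᶜ, F.2.compl⟩ disjoint_compl_right
  simp only [Set.union_compl_self, hX.map_univ] at h
  exact eq_orthosupp_of_padd h

/-- The Borel sets on which two observables agree form a Dynkin system, and the open half-lines
`(-∞, t)` are a π-system generating the Borel sets. -/
theorem ext_of_Iio (hX : IsObservable X) (hY : IsObservable Y)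
    (h : ∀ t : ℝ, X ⟨Set.Iio t, measurableSet_Iio⟩ = Y ⟨Set.Iio t, measurableSet_Iio⟩) : X = Y := by
  suffices ∀ (F : Set ℝ) (hF : MeasurableSet F), X ⟨F, hF⟩ = Y ⟨F, hF⟩ from
    funext fun F => this F.1 F.2
  refine MeasurableSpace.induction_on_inter
    ((BorelSpace.measurable_eq (α := ℝ)).trans (borel_eq_generateFrom_Iio ℝ)) isPiSystem_Iio
    ?_ ?_ ?_ ?_
  · rw [hX.map_empty, hY.map_empty]
  · rintro _ ⟨t, rfl⟩
    exact h t
  · intro F hF ih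
    rw [hX.map_compl ⟨F, hF⟩, hY.map_compl ⟨F, hF⟩, ih]
  · intro f hdisj hf ih
    let g : ℕ → BorelSets := fun n =>
      ⟨partialSups f n, by
        rw [partialSups_eq_biUnion_range]
        exact Finset.measurableSet_biUnion _ fun i _ => hf i⟩
    have hgu : ⋃ n, (g n).1 = ⋃ n, f n := iSup_partialSups_eq f
    have hgm : ∀ n, (g n).1 ⊆ (g (n + 1)).1 := fun n => (partialSups f).monotone n.le_succ
    have hg : ∀ n, X (g n) = Y (g n) := by
      intro n
      induction n with
      | zero => simpa [g] using ih 0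
      | succ n ihn =>
        have hd : Disjoint (g n).1 (f (n + 1)) := disjoint_partialSups_left.2 fun k hk =>
          hdisj (by omega)
        have e : g (n + 1) = ⟨(g n).1 ∪ f (n + 1), (g n).2.union (hf _)⟩ :=
          Subtype.ext (partialSups_add_one f n)
        have h1 := hX.map_union (g n) ⟨f (n + 1), hf _⟩ hd
        have h2 := hY.map_union (g n) ⟨f (n + 1), hf _⟩ hd
        rw [ihn, ih (n + 1), h2, Option.some_inj] at h1
        rw [e]
        exact h1.symm
    have hX' := hX.map_iUnion g hgm
    have hY' := hY.map_iUnion g hgm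
    simp only [hg, hgu] at hX' hY'
    exact hX'.unique hY'

end IsObservable

/-- In a σ-block, a left-continuous monotone family running from `0` to `1` is the distribution
function of a sharp observable that preserves intersections. -/
theorem IsSigmaBlock.exists_observable (hQ : SharpSumsAreJoins E) {S : Set E}
    (hS : IsSigmaBlock S) {x : ℝ → E} (hxS : ∀ t, x t ∈ S) (hmono : Monotone x)
    (hinf : IsGLB (Set.range x) 0) (hsup : IsLUB (Set.range x) 1)
    (hleft : ∀ s : ℝ, IsLUB (x '' Set.Iio s) (x s)) :
    ∃ X : BorelSets → E, (∀ t : ℝ, X ⟨Set.Iio t, measurableSet_Iio⟩ = x t) ∧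
      IsSharpObservable X ∧ PreservesInter X := by
  have hIio := Realizes.Iio hS hxS hmono hinf hsup hleft
  have hex : ∀ F : BorelSets, ∃ b, Realizes S x F.1 b := by
    suffices ∀ F : Set ℝ, MeasurableSet F → ∃ b, Realizes S x F b from fun F => this F.1 F.2
    refine MeasurableSpace.induction_on_inter
      ((BorelSpace.measurable_eq (α := ℝ)).trans (borel_eq_generateFrom_Iio ℝ)) isPiSystem_Iio
      ⟨0, Realizes.empty hS⟩ ?_ (fun F _ ⟨b, hb⟩ => ⟨_, hb.compl hS⟩) ?_
    · rintro _ ⟨t, rfl⟩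
      exact ⟨x t, hIio t⟩
    · intro f _ _ ih
      choose b hb using ih
      obtain ⟨c, hc, -⟩ := Realizes.iUnion hS hb
      exact ⟨c, hc⟩
  choose X hX using hex
  have hinter : PreservesInter X := fun F G => by
    obtain ⟨c, hc, hglb⟩ := (hX F).inter hS (hX G)
    exact (hX ⟨F.1 ∩ G.1, F.2.inter G.2⟩).unique hS hc ▸ hglb
  refine ⟨X, fun t => (hX _).unique hS (hIio t), ⟨⟨?_, fun F G hFG => ?_, fun F _ => ?_⟩,
    fun F => hS.isSharp _ (hX F).1⟩, hinter⟩
  · exact (hX _).unique hS (Realizes.univ hS)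
  · have hle : X G ≤ orthosupp (X F) := (hX G).le_of_subset hS ((hX F).compl hS)
      hFG.subset_compl_left
    obtain ⟨s, hs⟩ := exists_padd_of_le_orthosupp hle
    obtain ⟨c, hc, hlub⟩ := (hX F).union hS (hX G)
    rw [hs, (hX ⟨F.1 ∪ G.1, F.2.union G.2⟩).unique hS hc,
      (hQ _ _ _ _ (hS.isSharp _ (hX F).1) le_rfl hle hs).unique hlub]
  · obtain ⟨c, hc, hlub⟩ := Realizes.iUnion hS fun n => hX (F n)
    exact (hX ⟨⋃ n, (F n).1, _⟩).unique hS hc ▸ hlub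

end EffectAlgebra

theorem theorem3p12 {E : Type*} [EffectAlgebra E]
    (hE : EffectAlgebra.IsSigmaLattice E ∨
      (EffectAlgebra.IsMonotoneSigmaComplete E ∧ EffectAlgebra.HasRDP E))
    (x : ℝ → E)
    (hmono : ∀ t s : ℝ, t < s → x t ≤ x s)
    (hinf : IsGLB (Set.range x) 0)
    (hsup : IsLUB (Set.range x) 1)
    (hleft : ∀ s : ℝ, IsLUB (x '' Set.Iio s) (x s))
    (hsharp : ∀ t : ℝ, EffectAlgebra.IsSharp (x t)) :
    ∃ X : EffectAlgebra.BorelSets → E,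
      EffectAlgebra.IsObservable X ∧
      (∀ t : ℝ, X ⟨Set.Iio t, measurableSet_Iio⟩ = x t) ∧
      (∀ Y : EffectAlgebra.BorelSets → E, EffectAlgebra.IsObservable Y →
        (∀ t : ℝ, Y ⟨Set.Iio t, measurableSet_Iio⟩ = x t) → Y = X) ∧
      EffectAlgebra.IsSharpObservable X ∧
      EffectAlgebra.PreservesInter X := by
  obtain ⟨hQ, hM, hσ⟩ : EffectAlgebra.SharpSumsAreJoins E ∧ EffectAlgebra.SplitsInf E ∧
      EffectAlgebra.IsMonotoneSigmaComplete E := by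
    rcases hE with hL | ⟨hσ, hR⟩
    · exact ⟨hL.sharpSumsAreJoins, hL.splitsInf, fun f _ => (hL f).1⟩
    · exact ⟨hR.sharpSumsAreJoins, hR.splitsInf, hσ⟩
  have hx : Monotone x := monotone_iff_forall_lt.2 fun t s => hmono t s
  obtain ⟨S, hS, hxS⟩ := EffectAlgebra.exists_isSigmaBlock hQ hM hσ hx hsharp
  obtain ⟨X, hXx, hX, hXi⟩ := hS.exists_observable hQ hxS hx hinf hsup hleft
  exact ⟨X, hX.1, hXx, fun Y hY hYx => hY.ext_of_Iio hX.1 fun t => (hYx t).trans (hXx t).symm,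
    hX, hXi⟩
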